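/- **Setting.** Let $R$ be an integral domain with fraction field $K$, and let $A$ be an associative unital $R$-algebra which is cellular with cell datum $(\Lambda,M,C,i)$: $\Lambda$ is a finite poset; each $M(\lambda)$, $\lambda\in\Lambda$, is a finite non-empty set; $\{C^\lambda_{S,T}\mid \lambda\in\Lambda,\ S,T\in M(\lambda)\}$ is an $R$-basis of $A$; $i$ is an $R$-linear anti-automorphism of $A$ with $i^2=\mathrm{id}$ and $i(C^\lambda_{S,T})=C^\lambda_{T,S}$; and for all $a\in A$, $\lambda\in\Lambda$ and $S,T\in M(\lambda)$, $$aC^\lambda_{S,T}\equiv\sum_{S'\in M(\lambda)}r_a(S',S)\,C^\lambda_{S',T}\pmod{A(<\lambda)},$$ where $r_a(S',S)\in R$ is independent of $T$ and $A(<\lambda)$ is the $R$-span of all $C^\mu_{U,V}$ with $\mu<\lambda$. Suppose that $A$ is symmetric with symmetrizing trace $\tau:A\to R$, i.e. $\tau(a)=f(a,1)$ for an associative symmetric $R$-bilinear form $f$ on $A$ whose Gram matrix with respect to some $R$-basis of $A$ has determinant a unit of $R$. Let $\{D^\lambda_{S,T}\}$ be the dual basis, determined by $\tau(D^\mu_{U,V}C^\lambda_{S,T})=1$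 if $(\lambda,S,T)=(\mu,U,V)$ and $0$ otherwise. For $\lambda\in\Lambda$ choose any $T\in M(\lambda)$ and put $$x_\lambda=\sum_{S\in M(\lambda)}C^\lambda_{S,T}D^\lambda_{S,T}.$$ Let $A_K=K\otimes_R A\supseteq A$, extend $\tau$ $K$-linearly to $A_K$, and regard $A_K$ as a cellular $K$-algebra with the same cellular basis. The cell module $W(\lambda)$ of $A_K$ has $K$-basis $\{C_S\mid S\in M(\lambda)\}$ and action $aC_S=\sum_{S'}r_a(S',S)C_{S'}$. Let $\{b_i\}$ be the cellular basis of $A_K$ and $\{b_i^\vee\}$ its dual basis with respect to $\tau$. The Schur element of a split simple $A_K$-module $V$ is the unique $c_V\in K$ such that $$\sum_i b_i\,\varphi(b_i^\vee v)=c_V\,\mathrm{tr}(\varphi)\,v\qquad\text{for all }\varphi\in\mathrm{End}_K(V),\ v\in V.$$ **Proposition 4.2.** Suppose that $A_K$ is split semisimple, i.e. $A_K$ is semisimple and $\mathrm{End}_{A_K}(V)=K$ for every simple $A_K$-module $V$. Then: 1. For every $\lambda\in\Lambda$ there is exactly one $c_{W(\lambda)}\in K$ with the defining property of the Schur element of $W(\lambda)$;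 it is non-zero and satisfies $\sum_i\chi_{W(\lambda)}(b_i)\chi_{W(\lambda)}(b_i^\vee)=c_{W(\lambda)}\dim_K W(\lambda)$, where $\chi_{W(\lambda)}$ is the character of $W(\lambda)$. 2. The elements $c_{W(\lambda)}^{-1}x_\lambda$, $\lambda\in\Lambda$, lie in the center $Z(A_K)$, are pairwise orthogonal idempotents with sum $1$, are primitive in $Z(A_K)$, and every primitive idempotent of $Z(A_K)$ is one of them. 3. The family $(x_\lambda)_{\lambda\in\Lambda}$ is a $K$-basis of $Z(A_K)$. -/

import Mathlib

open scoped TensorProduct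

noncomputable section

/-! ### Symmetric algebras and dual bases -/

section Symmetric

variable {R : Type*} {A : Type*} [CommRing R] [Ring A] [Algebra R A]

/-- A linear map `τ : A → R` is a symmetrizing trace if it has the form `τ a = f (a, 1)` for an
associative symmetric bilinear form `f` on `A` that is non-degenerate, i.e. whose Gram matrix with
respect to some finite `R`-basis of `A` has a unit of `R` as determinant. -/
def IsSymmetrizingTrace (τ : A →ₗ[R] R) : Prop :=
  ∃ f : A →ₗ[R] A →ₗ[R] R,
    (∀ a b c, f (a * b) c = f a (b * c)) ∧
    (∀ a b, f a b = f b a) ∧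
    (∃ (n : ℕ) (b : Module.Basis (Fin n) R A),
      IsUnit (Matrix.of fun i j => f (b i) (b j)).det) ∧
    ∀ a, τ a = f a 1

open Classical in
/-- The dual basis of a finite basis `b` of `A` with respect to `τ`: the family
`D_j = ∑ k, (G⁻¹)_{j k} b_k`, with `G = (τ (b_i b_k))` the Gram matrix of `b`.  The lemmas
`mul_dualFamily` and `dualFamily_unique` show that it is the family determined by
`τ (D_j b_i) = δ_{i j}`. -/
def dualFamily {ι : Type*} [Fintype ι] (τ : A →ₗ[R] R) (b : Module.Basis ι R A) (j : ι) : A :=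
  ∑ k, (Matrix.of fun i k => τ (b i * b k))⁻¹ j k • b k

open Classical in
lemma isUnit_gram {ι : Type*} [Fintype ι] {τ : A →ₗ[R] R} (hτ : IsSymmetrizingTrace τ)
    (b : Module.Basis ι R A) : IsUnit (Matrix.of fun i k => τ (b i * b k)).det := by
  obtain ⟨f, hassoc, -, ⟨n, b', hdet⟩, hf⟩ := hτ
  have hfτ : ∀ x y, τ (x * y) = f x y := fun x y => by rw [hf, hassoc, mul_one]
  have hG : (Matrix.of fun i k => τ (b i * b k)) = LinearMap.toMatrix₂ b b f := by
    ext i k; simp [hfτ, LinearMap.toMatrix₂_apply]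
  have hG' : (Matrix.of fun i j => f (b' i) (b' j)) = LinearMap.toMatrix₂ b' b' f := by
    ext i k; simp [LinearMap.toMatrix₂_apply]
  rw [hG]
  rw [hG'] at hdet
  rcases subsingleton_or_nontrivial R with h | h
  · exact isUnit_of_subsingleton _
  have e : Fin n ≃ ι := b'.indexEquiv b
  have key := LinearMap.toMatrix₂_mul_basis_toMatrix (b₁ := b) (b₂ := b) (b'.reindex e)
    (b'.reindex e) f
  have h2 : LinearMap.toMatrix₂ (b'.reindex e) (b'.reindex e) f =
      (LinearMap.toMatrix₂ b' b' f).submatrix e.symm e.symm := by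
    ext i k; simp [LinearMap.toMatrix₂_apply]
  rw [h2] at key
  have h3 := congrArg Matrix.det key
  rw [Matrix.det_submatrix_equiv_self, Matrix.det_mul, Matrix.det_mul] at h3
  rw [← h3] at hdet
  exact isUnit_of_mul_isUnit_right (isUnit_of_mul_isUnit_left hdet)

open Classical in
/-- The defining property of the dual basis. -/
lemma mul_dualFamily {ι : Type*} [Fintype ι] {τ : A →ₗ[R] R} (hτ : IsSymmetrizingTrace τ)
    (b : Module.Basis ι R A) (i j : ι) :
    τ (dualFamily τ b j * b i) = if i = j then 1 else 0 := by
  have h := Matrix.nonsing_inv_mul _ (isUnit_gram hτ b)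
  have h2 := congrFun (congrFun h j) i
  rw [Matrix.mul_apply] at h2
  simp only [dualFamily, Finset.sum_mul, map_sum, smul_mul_assoc, map_smul, smul_eq_mul]
  simp only [Matrix.of_apply, Matrix.one_apply] at h2
  rw [h2]
  simp [eq_comm]

open Classical in
/-- The defining property determines the dual basis. -/
lemma dualFamily_unique {ι : Type*} [Fintype ι] {τ : A →ₗ[R] R} (hτ : IsSymmetrizingTrace τ)
    (b : Module.Basis ι R A) (D : ι → A)
    (hD : ∀ i j, τ (D j * b i) = if i = j then 1 else 0) : D = dualFamily τ b := by
  have hinv := Matrix.mul_nonsing_inv _ (isUnit_gram hτ b)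
  funext j
  rw [← sub_eq_zero]
  set x := D j - dualFamily τ b j with hx
  have h0 : ∀ i, τ (x * b i) = 0 := fun i => by
    rw [hx, sub_mul, map_sub, hD, mul_dualFamily hτ, sub_self]
  have hv : Matrix.vecMul (fun k => b.repr x k) (Matrix.of fun i k => τ (b i * b k)) = 0 := by
    funext i
    have := h0 i
    rw [← b.sum_repr x, Finset.sum_mul, map_sum] at this
    simpa [Matrix.vecMul, dotProduct] using this
  have h1 := congrArg (fun v => Matrix.vecMul v (Matrix.of fun i k => τ (b i * b k))⁻¹) hv
  simp only [Matrix.vecMul_vecMul, hinv, Matrix.vecMul_one, Matrix.zero_vecMul] at h1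
  rw [← b.sum_repr x]
  refine Finset.sum_eq_zero fun k _ => ?_
  have := congrFun h1 k
  simp only [Pi.zero_apply] at this
  rw [this, zero_smul]

/-- The `K`-linear extension of `τ : A → R` to `A_K = K ⊗ A`. -/
def extendTrace (K : Type*) [Field K] [Algebra R K] (τ : A →ₗ[R] R) : K ⊗[R] A →ₗ[K] K :=
  (TensorProduct.AlgebraTensorModule.rid R K K).toLinearMap ∘ₗ τ.baseChange K

lemma extendTrace_tmul (K : Type*) [Field K] [Algebra R K] (τ : A →ₗ[R] R) (k : K) (a : A) :
    extendTrace K τ (k ⊗ₜ[R] a) = τ a • k := by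
  simp [extendTrace]

end Symmetric

/-! ### Cellular algebras and cell modules -/

/-- A cell datum on the `R`-algebra `A`, with finite poset `Λ` and finite sets `M l`
for `l : Λ`. -/
structure CellDatum (R A Λ : Type*) (M : Λ → Type*) [CommRing R] [Ring A] [Algebra R A]
    [PartialOrder Λ] [Fintype Λ] [∀ l, Fintype (M l)] where
  /-- The cellular basis; the index `⟨l, S, T⟩` stands for `C^l_{S,T}`. -/
  basis : Module.Basis (Σ l, M l × M l) R A
  /-- The anti-involution. -/
  inv : A →ₗ[R] A
  inv_mul : ∀ a b, inv (a * b) = inv b * inv a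
  inv_inv : ∀ a, inv (inv a) = a
  inv_basis : ∀ (l : Λ) (S T : M l), inv (basis ⟨l, S, T⟩) = basis ⟨l, T, S⟩
  /-- `a C_{S,T} ≡ ∑ S', r_a(S', S) C_{S',T}` modulo the span of the lower cells,
  with `r_a(S', S)` independent of `T`. -/
  mul_basis : ∀ (l : Λ) (a : A), ∃ r : M l → M l → R, ∀ S T : M l,
    a * basis ⟨l, S, T⟩ - ∑ S', r S' S • basis ⟨l, S', T⟩ ∈
      Submodule.span R {x | ∃ (m : Λ) (U V : M m), m < l ∧ x = basis ⟨m, U, V⟩}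

namespace CellDatum

variable {R A Λ : Type*} {M : Λ → Type*} [CommRing R] [Ring A] [Algebra R A]
  [PartialOrder Λ] [Fintype Λ] [∀ l, Fintype (M l)] (D : CellDatum R A Λ M)

/-- The submodule `A(< l)`, spanned by the cellular basis elements of the cells below `l`. -/
def lower (l : Λ) : Submodule R A :=
  Submodule.span R {x | ∃ (m : Λ) (U V : M m), m < l ∧ x = D.basis ⟨m, U, V⟩}

/-- The coefficient `r_a(S', S)`: the coefficient of `C_{S',S}` in `a C_{S,S}`
(any `C_{S',T}` and `a C_{S,T}` give the same, see `repr_mul_basis`). -/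
def coeff (l : Λ) (a : A) : Matrix (M l) (M l) R :=
  Matrix.of fun S' S => D.basis.repr (a * D.basis ⟨l, S, S⟩) ⟨l, S', S⟩

lemma repr_lower {l : Λ} {x : A} (hx : x ∈ D.lower l) (S T : M l) :
    D.basis.repr x ⟨l, S, T⟩ = 0 := by
  classical
  induction hx using Submodule.span_induction with
  | mem x h =>
    obtain ⟨m, U, V, hm, rfl⟩ := h
    rw [Module.Basis.repr_self, Finsupp.single_apply, if_neg]
    intro h
    exact hm.ne (congrArg Sigma.fst h)
  | zero => simp
  | add x y _ _ hx hy => simp [hx, hy]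
  | smul a x _ hx => simp [hx]

lemma repr_mul_basis_aux {l : Λ} {a : A} {r : M l → M l → R}
    (hr : ∀ S T : M l, a * D.basis ⟨l, S, T⟩ - ∑ S', r S' S • D.basis ⟨l, S', T⟩ ∈ D.lower l)
    (S' S T : M l) : D.basis.repr (a * D.basis ⟨l, S, T⟩) ⟨l, S', T⟩ = r S' S := by
  classical
  have h := D.repr_lower (hr S T) S' T
  rw [map_sub, Finsupp.sub_apply, sub_eq_zero] at h
  rw [h, map_sum, Finsupp.finsetSum_apply, Finset.sum_eq_single S']
  · simp
  · intro b _ hb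
    simp [hb]
  · simp

lemma repr_mul_basis (l : Λ) (a : A) (S' S T : M l) :
    D.basis.repr (a * D.basis ⟨l, S, T⟩) ⟨l, S', T⟩ = D.coeff l a S' S := by
  obtain ⟨r, hr⟩ := D.mul_basis l a
  rw [D.repr_mul_basis_aux hr, coeff, Matrix.of_apply, D.repr_mul_basis_aux hr]

/-- The coefficients `r_a(S', S)` satisfy the congruence of the cell datum. -/
lemma mul_basis_sub_mem (l : Λ) (a : A) (S T : M l) :
    a * D.basis ⟨l, S, T⟩ - ∑ S', D.coeff l a S' S • D.basis ⟨l, S', T⟩ ∈ D.lower l := by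
  obtain ⟨r, hr⟩ := D.mul_basis l a
  have : ∀ S', D.coeff l a S' S = r S' S := fun S' => by
    rw [← D.repr_mul_basis l a S' S T, D.repr_mul_basis_aux hr]
  simp only [this]
  exact hr S T

lemma lower_mono {m l : Λ} (h : m ≤ l) : D.lower m ≤ D.lower l := by
  refine Submodule.span_mono ?_
  rintro x ⟨k, U, V, hk, rfl⟩
  exact ⟨k, U, V, hk.trans_le h, rfl⟩

lemma mul_mem_lower {l : Λ} (a : A) {x : A} (hx : x ∈ D.lower l) : a * x ∈ D.lower l := by
  induction hx using Submodule.span_induction with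
  | mem x h =>
    obtain ⟨m, U, V, hm, rfl⟩ := h
    have h := D.lower_mono hm.le (D.mul_basis_sub_mem m a U V)
    rw [← sub_add_cancel (a * D.basis ⟨m, U, V⟩)]
    refine add_mem h (Submodule.sum_mem _ fun S' _ => Submodule.smul_mem _ _ ?_)
    exact Submodule.subset_span ⟨m, S', V, hm, rfl⟩
  | zero => simp
  | add x y _ _ hx hy => rw [mul_add]; exact add_mem hx hy
  | smul c x _ hx => rw [mul_smul_comm]; exact Submodule.smul_mem _ _ hx

open Classical in
lemma coeff_one (l : Λ) : D.coeff l 1 = 1 := by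
  ext S' S
  rw [coeff, Matrix.of_apply, one_mul, Module.Basis.repr_self, Finsupp.single_apply,
    Matrix.one_apply]
  by_cases h : S' = S
  · simp [h]
  · rw [if_neg, if_neg h]
    intro h'
    simp only [Sigma.mk.injEq, heq_eq_eq, Prod.mk.injEq, true_and, and_true] at h'
    exact h h'.symm

lemma coeff_mul (l : Λ) (a b : A) : D.coeff l (a * b) = D.coeff l a * D.coeff l b := by
  ext S' S
  have h := D.repr_lower (D.mul_mem_lower a (D.mul_basis_sub_mem l b S S)) S' S
  rw [mul_sub, map_sub, Finsupp.sub_apply, sub_eq_zero] at h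
  rw [coeff, Matrix.of_apply, mul_assoc, h, Finset.mul_sum, map_sum, Finsupp.finsetSum_apply,
    Matrix.mul_apply]
  refine Finset.sum_congr rfl fun T _ => ?_
  rw [mul_smul_comm, map_smul, Finsupp.smul_apply, D.repr_mul_basis, smul_eq_mul, mul_comm]

lemma coeff_add (l : Λ) (a b : A) : D.coeff l (a + b) = D.coeff l a + D.coeff l b := by
  ext; simp [coeff, add_mul]

lemma coeff_smul (l : Λ) (c : R) (a : A) : D.coeff l (c • a) = c • D.coeff l a := by
  ext; simp [coeff]

/-- The cell module `W(l)`: the free `R`-module on `M l` (the basis vector `C_S` is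
`Pi.single S 1`), with the action of `A` given by `a C_S = ∑ S', r_a(S', S) C_{S'}`. -/
def CellModule (_D : CellDatum R A Λ M) (l : Λ) : Type _ := M l → R

instance (l : Λ) : AddCommGroup (D.CellModule l) := inferInstanceAs (AddCommGroup (M l → R))

instance (l : Λ) : Module R (D.CellModule l) := inferInstanceAs (Module R (M l → R))

instance (l : Λ) : Module A (D.CellModule l) where
  smul a w := (D.coeff l a).mulVec w
  one_smul w := by
    classical
    exact (congrArg (fun X => Matrix.mulVec X w) (D.coeff_one l)).trans (Matrix.one_mulVec _)
  mul_smul a b w :=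
    (congrArg (fun X => Matrix.mulVec X w) (D.coeff_mul l a b)).trans
      (Matrix.mulVec_mulVec _ _ _).symm
  smul_zero a := Matrix.mulVec_zero _
  smul_add a v w := Matrix.mulVec_add _ _ _
  add_smul a b w :=
    (congrArg (fun X => Matrix.mulVec X w) (D.coeff_add l a b)).trans (Matrix.add_mulVec _ _ _)
  zero_smul w := by
    have : D.coeff l (0 : A) = 0 := by ext; simp [coeff]
    exact (congrArg (fun X => Matrix.mulVec X w) this).trans (Matrix.zero_mulVec _)

instance (l : Λ) : IsScalarTower R A (D.CellModule l) where
  smul_assoc c a w :=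
    (congrArg (fun X => Matrix.mulVec X w) (D.coeff_smul l c a)).trans
      (Matrix.smul_mulVec _ _ _)

/-- The cell datum on `A_K = K ⊗ A` with the cellular basis `1 ⊗ C^l_{S,T}`. -/
def extend (K : Type*) [Field K] [Algebra R K] : CellDatum K (K ⊗[R] A) Λ M where
  basis := D.basis.baseChange K
  inv := D.inv.baseChange K
  inv_mul x y := by
    induction x with
    | zero => simp
    | add x₁ x₂ h₁ h₂ => simp only [add_mul, mul_add, map_add, h₁, h₂]
    | tmul k a =>
      induction y with
      | zero => simp
      | add y₁ y₂ h₁ h₂ => simp only [add_mul, mul_add, map_add, h₁, h₂]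
      | tmul k' a' => simp [D.inv_mul, mul_comm]
  inv_inv x := by
    induction x with
    | zero => simp
    | add x₁ x₂ h₁ h₂ => simp only [map_add, h₁, h₂]
    | tmul k a => simp [D.inv_inv]
  inv_basis l S T := by simp [Module.Basis.baseChange_apply, D.inv_basis]
  mul_basis l x := by
    induction x with
    | zero => exact ⟨0, fun S T => by simp⟩
    | add x₁ x₂ h₁ h₂ =>
      obtain ⟨r₁, h₁⟩ := h₁
      obtain ⟨r₂, h₂⟩ := h₂
      refine ⟨r₁ + r₂, fun S T => ?_⟩
      have := add_mem (h₁ S T) (h₂ S T)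
      simp only [Pi.add_apply, add_smul, Finset.sum_add_distrib, add_mul]
      convert this using 1
      abel
    | tmul k a =>
      refine ⟨fun S' S => k * algebraMap R K (D.coeff l a S' S), fun S T => ?_⟩
      have hlow : ∀ y ∈ D.lower l, k ⊗ₜ[R] y ∈ Submodule.span K
          {x | ∃ (m : Λ) (U V : M m), m < l ∧ x = (D.basis.baseChange K) ⟨m, U, V⟩} := by
        intro y hy
        induction hy using Submodule.span_induction with
        | mem y h =>
          obtain ⟨m, U, V, hm, rfl⟩ := h
          have : k ⊗ₜ[R] D.basis ⟨m, U, V⟩ = k • (D.basis.baseChange K) ⟨m, U, V⟩ := by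
            simp [Module.Basis.baseChange_apply, TensorProduct.smul_tmul']
          rw [this]
          exact Submodule.smul_mem _ _ (Submodule.subset_span ⟨m, U, V, hm, rfl⟩)
        | zero => simp
        | add x y _ _ hx hy => rw [TensorProduct.tmul_add]; exact add_mem hx hy
        | smul c x _ hx =>
          rw [TensorProduct.tmul_smul, ← algebraMap_smul K c]
          exact Submodule.smul_mem _ _ hx
      have h := hlow _ (D.mul_basis_sub_mem l a S T)
      convert h using 1
      rw [TensorProduct.tmul_sub, TensorProduct.tmul_sum]
      simp only [Module.Basis.baseChange_apply, Algebra.TensorProduct.tmul_mul_tmul, mul_one]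
      congr 1
      refine Finset.sum_congr rfl fun S' _ => ?_
      generalize D.coeff l a S' S = r
      rw [TensorProduct.tmul_smul, TensorProduct.smul_tmul', TensorProduct.smul_tmul',
        Algebra.smul_def r k, smul_eq_mul, mul_one, mul_comm]

/-- The element `x_l = ∑ S, C^l_{S,T} D^l_{S,T}` of `A`, formed with the index `T`, where the
`D^l_{S,T}` are the dual basis of the cellular basis with respect to `τ`. -/
def cellElement (τ : A →ₗ[R] R) {l : Λ} (T : M l) : A :=
  ∑ S : M l, D.basis ⟨l, S, T⟩ * dualFamily τ D.basis ⟨l, S, T⟩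

end CellDatum

/-! ### Split semisimple algebras, Schur elements, primitive idempotents -/

/-- A `K`-algebra `A` is split semisimple if it is semisimple and every simple `A`-module `V` is
split, i.e. has only the scalars in `K` as `A`-endomorphisms. -/
structure IsSplitSemisimple.{u, v} (K : Type u) (A : Type v) [Field K] [Ring A] [Algebra K A] :
    Prop where
  semisimple : IsSemisimpleRing A
  split : ∀ (V : Type v) [AddCommGroup V] [Module K V] [Module A V] [IsScalarTower K A V]
    [IsSimpleModule A V] (φ : V →ₗ[A] V), ∃ c : K, ∀ v, φ v = c • v

section Schur

variable {K A ι : Type*} [Field K] [Ring A] [Algebra K A] [Fintype ι]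

/-- The character afforded by the `A`-module `V`. -/
def characterOf (K : Type*) {A : Type*} [Field K] [Ring A] [Algebra K A] (V : Type*)
    [AddCommGroup V] [Module K V] [Module A V] [IsScalarTower K A V] (a : A) : K :=
  LinearMap.trace K V (Algebra.lsmul K K V a)

/-- The defining property of the Schur element `c` of `V`: for every `K`-linear `φ : V → V`, the
map `∑ i, b_i φ b_i^∨` is multiplication by `c * tr φ`, where `b^∨` is the dual basis of the
basis `b` of `A` with respect to `τ`. -/
def IsSchurElement (τ : A →ₗ[K] K) (b : Module.Basis ι K A) (V : Type*)
    [AddCommGroup V] [Module K V] [Module A V] (c : K) : Prop :=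
  ∀ (φ : V →ₗ[K] V) (v : V),
    ∑ i, b i • φ (dualFamily τ b i • v) = (c * LinearMap.trace K V φ) • v

/-- The Schur element `c_V` of `V` (an arbitrary scalar if no scalar has the defining
property). -/
def schurElement (τ : A →ₗ[K] K) (b : Module.Basis ι K A) (V : Type*)
    [AddCommGroup V] [Module K V] [Module A V] : K :=
  Classical.epsilon (IsSchurElement τ b V)

end Schur

/-- Primitive idempotents of a ring: nonzero idempotents that are not the sum of two nonzero
orthogonal idempotents. -/
def IsPrimitiveIdempotent {Z : Type*} [Ring Z] (e : Z) : Prop :=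
  IsIdempotentElem e ∧ e ≠ 0 ∧
    ∀ f g : Z, IsIdempotentElem f → IsIdempotentElem g → f * g = 0 → g * f = 0 → f + g = e →
      f = 0 ∨ g = 0

end

/-! A semisimple cellular algebra is the product of the full matrix algebras of its cell modules,
and everything is computed there. By the anti-involution, `C^l_{S,T}` acts on `W(l)` as a matrix
whose only nonzero row is row `S`, filled with row `T` of the Gram matrix of the cell form
(`coeff_basis_same`). Semisimplicity makes this Gram matrix invertible (`isUnit_cell_gram`); a
triangularity argument along the poset and a dimension count then give `cellEquiv`.

A symmetrizing trace on a product of matrix algebras is a combination of the block traces with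
nonzero weights `t_l`. Dual bases therefore satisfy Schur's orthogonality relations with constants
`t_l⁻¹`, so the Schur element of `W(l)` is `t_l⁻¹` (`isSchurElement_iff`).

`C^l` acts as zero on `W(m)` unless `m ≤ l`, and `D^l` unless `l ≤ m`, so `x_l` lives in the block
`l` alone. There it is the scalar `t_l⁻¹` (`cellElement_eq`): `x_l` is the Schur element times the
block idempotent. The claims on the center are then those for the block idempotents. -/

noncomputable section

/-! ### Cell ideals, cell forms and the action of the cellular basis on the cell modules. -/

section CellularFacts

open scoped Classical

namespace CellDatum

variable {R A Λ : Type*} {M : Λ → Type*} [CommRing R] [Ring A] [Algebra R A]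
  [PartialOrder Λ] [Fintype Λ] [∀ l, Fintype (M l)] (D : CellDatum R A Λ M)

lemma inv_mem_lower {l : Λ} {x : A} (hx : x ∈ D.lower l) : D.inv x ∈ D.lower l := by
  induction hx using Submodule.span_induction with
  | mem x h =>
    obtain ⟨m, U, V, hm, rfl⟩ := h
    rw [D.inv_basis]
    exact Submodule.subset_span ⟨m, V, U, hm, rfl⟩
  | zero => simp
  | add x y _ _ hx hy => rw [map_add]; exact add_mem hx hy
  | smul c x _ hx => rw [map_smul]; exact Submodule.smul_mem _ _ hx

lemma lower_mul_mem {l : Λ} (a : A) {x : A} (hx : x ∈ D.lower l) : x * a ∈ D.lower l := by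
  rw [← D.inv_inv (x * a), D.inv_mul]
  exact D.inv_mem_lower (D.mul_mem_lower _ (D.inv_mem_lower hx))

lemma repr_lower_of_not_lt {l m : Λ} (h : ¬ m < l) {x : A} (hx : x ∈ D.lower l) (S T : M m) :
    D.basis.repr x ⟨m, S, T⟩ = 0 := by
  induction hx using Submodule.span_induction with
  | mem x hx =>
    obtain ⟨k, U, V, hk, rfl⟩ := hx
    rw [Module.Basis.repr_self, Finsupp.single_apply, if_neg]
    intro h'
    obtain rfl : k = m := congrArg Sigma.fst h'
    exact h hk
  | zero => simp
  | add x y _ _ hx hy => simp [hx, hy]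
  | smul a x _ hx => simp [hx]

lemma repr_inv (x : A) (l : Λ) (S T : M l) :
    D.basis.repr (D.inv x) ⟨l, S, T⟩ = D.basis.repr x ⟨l, T, S⟩ := by
  have h : (D.basis.coord ⟨l, S, T⟩) ∘ₗ D.inv = D.basis.coord ⟨l, T, S⟩ := by
    refine D.basis.ext ?_
    rintro ⟨m, U, V⟩
    simp only [LinearMap.comp_apply, D.inv_basis, Module.Basis.coord_apply,
      Module.Basis.repr_self, Finsupp.single_apply]
    by_cases hm : m = l
    · subst hm
      simp [and_comm]
    · rw [if_neg fun h => hm (congrArg Sigma.fst h), if_neg fun h => hm (congrArg Sigma.fst h)]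
  exact LinearMap.congr_fun h x

lemma repr_mul_basis_of_not_le {l m : Λ} (h : ¬ m ≤ l) (a : A) (S T : M l) (U V : M m) :
    D.basis.repr (a * D.basis ⟨l, S, T⟩) ⟨m, U, V⟩ = 0 := by
  have h1 := D.repr_lower_of_not_lt (fun h' => h h'.le) (D.mul_basis_sub_mem l a S T) U V
  rw [map_sub, Finsupp.sub_apply, sub_eq_zero] at h1
  rw [h1, map_sum, Finsupp.finsetSum_apply]
  refine Finset.sum_eq_zero fun S' _ => ?_
  rw [map_smul, Finsupp.smul_apply, Module.Basis.repr_self, Finsupp.single_apply, if_neg,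
    smul_zero]
  intro h'
  exact h (congrArg Sigma.fst h').ge

lemma repr_basis_mul_of_not_le {l m : Λ} (h : ¬ m ≤ l) (a : A) (S T : M l) (U V : M m) :
    D.basis.repr (D.basis ⟨l, S, T⟩ * a) ⟨m, U, V⟩ = 0 := by
  rw [← D.repr_inv, D.inv_mul, D.inv_basis]
  exact D.repr_mul_basis_of_not_le h _ _ _ _ _

lemma repr_mul_basis_same (l : Λ) (a : A) (S T U V : M l) :
    D.basis.repr (a * D.basis ⟨l, S, T⟩) ⟨l, U, V⟩ = if V = T then D.coeff l a U S else 0 := by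
  have h1 := D.repr_lower (D.mul_basis_sub_mem l a S T) U V
  rw [map_sub, Finsupp.sub_apply, sub_eq_zero] at h1
  rw [h1, map_sum, Finsupp.finsetSum_apply]
  simp only [map_smul, Finsupp.smul_apply, Module.Basis.repr_self, Finsupp.single_apply,
    Sigma.mk.injEq, heq_eq_eq, Prod.mk.injEq, true_and, smul_eq_mul, mul_ite, mul_one, mul_zero]
  by_cases h : V = T
  · subst h; simp
  · simp [h, Ne.symm h]

/-- The matrix of the bilinear form of the cell module: `C_{S,T} C_{U,V}` is congruent to
`gram T U • C_{S,V}` modulo the lower cells. -/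
def gram (l : Λ) : Matrix (M l) (M l) R :=
  Matrix.of fun T U => D.coeff l (D.basis ⟨l, T, T⟩) T U

/-- The product `C_{S,T} C_{U,V}` can be expanded by the left action on `C_{U,V}` or, through the
anti-involution, by the right action on `C_{S,T}`. Comparing coefficients forces the first index to
stay `S`, and the remaining scalar depends only on `T` and `U`. -/
lemma coeff_basis_same (l : Λ) (S T S' U : M l) :
    D.coeff l (D.basis ⟨l, S, T⟩) S' U = if S' = S then D.gram l T U else 0 := by
  have key : ∀ S T S' U V : M l, D.coeff l (D.basis ⟨l, S, T⟩) S' U =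
      if S' = S then D.coeff l (D.basis ⟨l, V, U⟩) V T else 0 := by
    intro S T S' U V
    have h1 := D.repr_mul_basis_same l (D.basis ⟨l, S, T⟩) U V S' V
    rw [if_pos rfl] at h1
    rw [← h1, ← D.repr_inv, D.inv_mul, D.inv_basis, D.inv_basis, D.repr_mul_basis_same]
  rw [key S T S' U U, gram, Matrix.of_apply, key T T T U U, if_pos rfl]

lemma coeff_basis_of_not_le {l m : Λ} (h : ¬ l ≤ m) (S T : M m) :
    D.coeff l (D.basis ⟨m, S, T⟩) = 0 := by
  ext U V
  exact D.repr_basis_mul_of_not_le h _ _ _ _ _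

lemma basis_mul_sub_mem (l : Λ) (a : A) (S T : M l) :
    D.basis ⟨l, S, T⟩ * a - ∑ T', D.coeff l (D.inv a) T' T • D.basis ⟨l, S, T'⟩ ∈ D.lower l := by
  have h := D.inv_mem_lower (D.mul_basis_sub_mem l (D.inv a) T S)
  simpa only [map_sub, D.inv_mul, D.inv_inv, D.inv_basis, map_sum, map_smul] using h

/-- The representations afforded by the cell modules, combined. -/
def cellRep : A →ₐ[R] ∀ l, Matrix (M l) (M l) R :=
  AlgHom.ofLinearMap
    { toFun := fun a l => D.coeff l a
      map_add' := fun a b => funext fun l => D.coeff_add l a b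
      map_smul' := fun c a => funext fun l => D.coeff_smul l c a }
    (funext fun l => D.coeff_one l) fun a b => funext fun l => D.coeff_mul l a b

@[simp] lemma cellRep_apply (a : A) (l : Λ) : D.cellRep a l = D.coeff l a := rfl

lemma coeff_eq_sum (l : Λ) (a : A) :
    D.coeff l a = ∑ i, D.basis.repr a i • D.coeff l (D.basis i) := by
  have h := congrFun (congrArg D.cellRep (D.basis.sum_repr a)) l
  rw [map_sum, Finset.sum_apply, cellRep_apply] at h
  simpa only [cellRep_apply, D.coeff_smul] using h.symm

end CellDatum

/-- Von Neumann regularity: the left ideal of `y` is generated by an idempotent `b * y`, and right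
multiplication by this idempotent fixes `y`. -/
lemma IsSemisimpleRing.exists_mul_mul_eq_self {B : Type*} [Ring B] [IsSemisimpleRing B] (y : B) :
    ∃ z, y * z * y = y := by
  obtain ⟨e, he, h⟩ := IsSemisimpleRing.ideal_eq_span_idempotent (Ideal.span {y})
  have h1 : e ∈ Ideal.span {y} := h ▸ Ideal.mem_span_singleton_self e
  have h2 : y ∈ Ideal.span {e} := h ▸ Ideal.mem_span_singleton_self y
  obtain ⟨b, rfl⟩ := Ideal.mem_span_singleton'.1 h1
  obtain ⟨c, hc⟩ := Ideal.mem_span_singleton'.1 h2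
  refine ⟨b, ?_⟩
  rw [mul_assoc]
  nth_rw 1 [← hc]
  rw [mul_assoc, he.eq, hc]

/-! ### Semisimple cellular algebras as products of matrix algebras. -/

namespace CellDatum

variable {K B Λ : Type*} {M : Λ → Type*} [Field K] [Ring B] [Algebra K B]
  [PartialOrder Λ] [Fintype Λ] [∀ l, Fintype (M l)] (D : CellDatum K B Λ M)

/-- A vector `v` in the radical of the cell form yields an element `y` of the cell `l` that is
killed on the left by that cell modulo lower cells. Regularity, `y = y z y`, then pushes `y` itself
into the lower cells, so its coefficients `v` vanish. -/
lemma isUnit_cell_gram [IsSemisimpleRing B] (l : Λ) : IsUnit (D.gram l) := by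
  rw [← Matrix.mulVec_injective_iff_isUnit]
  refine (injective_iff_map_eq_zero (D.gram l).mulVecLin).2 fun v hv => ?_
  funext T
  rw [Matrix.mulVecLin_apply] at hv
  set y := ∑ U, v U • D.basis ⟨l, U, T⟩ with hy
  obtain ⟨z, hz⟩ := IsSemisimpleRing.exists_mul_mul_eq_self y
  have hC : ∀ S V : M l, D.basis ⟨l, S, V⟩ * y ∈ D.lower l := by
    intro S V
    have h : D.basis ⟨l, S, V⟩ * y = ∑ U, v U • (D.basis ⟨l, S, V⟩ * D.basis ⟨l, U, T⟩ -
        ∑ S', D.coeff l (D.basis ⟨l, S, V⟩) S' U • D.basis ⟨l, S', T⟩) := by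
      have h0 := congrFun hv V
      simp only [Matrix.mulVec, dotProduct, Pi.zero_apply] at h0
      simp only [smul_sub, Finset.sum_sub_distrib, D.coeff_basis_same, ite_smul, zero_smul,
        Finset.sum_ite_eq', Finset.mem_univ, if_true, smul_smul, ← Finset.sum_smul,
        mul_comm (v _), h0, sub_zero, hy, Finset.mul_sum, mul_smul_comm]
    rw [h]
    exact Submodule.sum_mem _ fun U _ => Submodule.smul_mem _ _ (D.mul_basis_sub_mem _ _ _ _)
  have hyl : y ∈ D.lower l := by
    rw [← hz]
    nth_rw 1 [hy]
    rw [Finset.sum_mul, Finset.sum_mul]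
    refine Submodule.sum_mem _ fun U _ => ?_
    rw [smul_mul_assoc, smul_mul_assoc]
    refine Submodule.smul_mem _ _ ?_
    -- Modulo lower cells, `C_{U,T} z` is a combination of the `C_{U,T'}`, and each `C_{U,T'} y` is
    -- already lower.
    have h := add_mem (D.lower_mul_mem y (D.basis_mul_sub_mem l z U T))
      (Submodule.sum_mem (D.lower l) fun (T' : M l) (_ : T' ∈ Finset.univ) =>
        Submodule.smul_mem _ (D.coeff l (D.inv z) T' T) (hC U T'))
    simpa only [sub_mul, Finset.sum_mul, smul_mul_assoc, sub_add_cancel] using h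
  have h := D.repr_lower hyl T T
  rw [hy, map_sum, Finsupp.finsetSum_apply, Finset.sum_eq_single T] at h
  · simpa using h
  · intro U _ hU
    simp [hU]
  · simp

lemma cellRep_injective [IsSemisimpleRing B] : Function.Injective D.cellRep := by
  refine (injective_iff_map_eq_zero D.cellRep).2 fun b hb => ?_
  by_contra hb0
  have hne : {l : Λ | ∃ S T : M l, D.basis.repr b ⟨l, S, T⟩ ≠ 0}.Nonempty := by
    by_contra h
    refine hb0 (D.basis.repr.map_eq_zero_iff.1 (Finsupp.ext ?_))
    rintro ⟨l, S, T⟩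
    by_contra h'
    exact h ⟨l, S, T, h'⟩
  -- For a cell `l` maximal in the support of `b`, cells strictly above `l` have coefficient zero
  -- and cells not above `l` act as zero on `W(l)`. So `b` acts on `W(l)` through its
  -- `l`-coefficients alone, as `X * D.gram l`.
  obtain ⟨l, hl⟩ := (Set.toFinite _).exists_maximal hne
  obtain ⟨S, T, hST⟩ := hl.prop
  set X : Matrix (M l) (M l) K := Matrix.of fun S T => D.basis.repr b ⟨l, S, T⟩ with hX
  have hXG : X * D.gram l = 0 := by
    ext S U
    have h0 := congrFun (congrFun (congrFun hb l) S) U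
    rw [cellRep_apply, coeff_eq_sum, Fintype.sum_sigma, Finset.sum_eq_single l,
      Fintype.sum_prod_type] at h0
    · simpa only [Matrix.sum_apply, Matrix.smul_apply, D.coeff_basis_same, smul_eq_mul, mul_ite,
        mul_zero, Finset.sum_comm (s := Finset.univ (α := M l)), Finset.sum_ite_eq,
        Finset.mem_univ, if_true, Pi.zero_apply, Matrix.zero_apply, Matrix.mul_apply, hX,
        Matrix.of_apply] using h0
    · intro m _ hm
      refine Finset.sum_eq_zero ?_
      rintro ⟨U, V⟩ -
      by_cases hlm : l ≤ m
      · have : D.basis.repr b ⟨m, U, V⟩ = 0 := by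
          by_contra h'
          exact hm (le_antisymm (hl.le_of_ge ⟨U, V, h'⟩ hlm) hlm)
        rw [this, zero_smul]
      · rw [D.coeff_basis_of_not_le hlm, smul_zero]
    · simp
  have hX0 : X = 0 := (D.isUnit_cell_gram l).mul_left_eq_zero.1 hXG
  exact hST (congrFun (congrFun hX0 S) T)

lemma cellRep_bijective [IsSemisimpleRing B] : Function.Bijective D.cellRep := by
  refine ⟨D.cellRep_injective, ?_⟩
  have : FiniteDimensional K B := D.basis.finiteDimensional_of_finite
  -- Both sides have dimension `∑ l, |M l|²`.
  refine (LinearMap.injective_iff_surjective_of_finrank_eq_finrank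
    (f := D.cellRep.toLinearMap) ?_).1 D.cellRep_injective
  rw [Module.finrank_eq_card_basis D.basis, Module.finrank_pi_fintype]
  simp [Module.finrank_matrix]

/-- A semisimple cellular algebra is the product of the matrix algebras of its cell modules. -/
def cellEquiv [IsSemisimpleRing B] : B ≃ₐ[K] ∀ l, Matrix (M l) (M l) K :=
  AlgEquiv.ofBijective D.cellRep D.cellRep_bijective

@[simp] lemma cellEquiv_apply [IsSemisimpleRing B] (b : B) (l : Λ) :
    D.cellEquiv b l = D.coeff l b := rfl

end CellDatum

end CellularFacts

/-! ### Symmetrizing traces, their scalar extension, and Schur relations on products of matrix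
algebras. -/

section MatrixProducts

open scoped Classical

lemma Matrix.eq_mul_trace_of_map_mul_comm {n K : Type*} [Fintype n] [Field K]
    (f : Matrix n n K →ₗ[K] K) (hf : ∀ X Y, f (X * Y) = f (Y * X)) (o : n) (X : Matrix n n K) :
    f X = f (Matrix.single o o 1) * X.trace := by
  have hs : ∀ i j : n, f (Matrix.single i j 1) = if i = j then f (Matrix.single o o 1) else 0 := by
    intro i j
    -- Swapping these two factors gives zero for `i ≠ j` and the unit at `(o, o)` for `i = j`.
    have h1 : Matrix.single i j (1 : K) = Matrix.single i o 1 * Matrix.single o j 1 := by simp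
    rw [h1, hf]
    by_cases h : i = j
    · subst h; simp
    · simp [h, Ne.symm h]
  generalize f (Matrix.single o o 1) = t at hs ⊢
  conv_lhs => rw [Matrix.matrix_eq_sum_single X]
  have hx : ∀ i j, Matrix.single i j (X i j) = X i j • Matrix.single i j (1 : K) := by simp
  simp only [map_sum, hx, map_smul, hs, smul_eq_mul, mul_ite, mul_zero, Finset.sum_ite_eq,
    Finset.mem_univ, if_true, Matrix.trace, Matrix.diag_apply, Finset.mul_sum, mul_comm]

namespace IsSymmetrizingTrace

variable {R A : Type*} [CommRing R] [Ring A] [Algebra R A] {τ : A →ₗ[R] R}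

lemma map_mul_comm (hτ : IsSymmetrizingTrace τ) (a b : A) : τ (a * b) = τ (b * a) := by
  obtain ⟨f, hassoc, hsymm, -, hf⟩ := hτ
  rw [hf, hf, hassoc, hassoc, mul_one, mul_one, hsymm]

lemma map_dualFamily_mul {ι : Type*} [Fintype ι] (hτ : IsSymmetrizingTrace τ)
    (b : Module.Basis ι R A) (i : ι) (a : A) : τ (dualFamily τ b i * a) = b.repr a i := by
  have h : τ ∘ₗ LinearMap.mulLeft R (dualFamily τ b i) = b.coord i :=
    b.ext fun j => by simp [mul_dualFamily hτ, Finsupp.single_apply]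
  exact LinearMap.congr_fun h a

lemma sum_map_mul_smul {ι : Type*} [Fintype ι] (hτ : IsSymmetrizingTrace τ)
    (b : Module.Basis ι R A) (a : A) : ∑ i, τ (dualFamily τ b i * a) • b i = a := by
  simp only [hτ.map_dualFamily_mul, b.sum_repr]

lemma eq_zero_of_map_mul_eq_zero (hτ : IsSymmetrizingTrace τ) {x : A} (hx : ∀ a, τ (x * a) = 0) :
    x = 0 := by
  obtain ⟨-, -, -, ⟨n, b, -⟩, -⟩ := id hτ
  rw [← hτ.sum_map_mul_smul b x]
  refine Finset.sum_eq_zero fun i _ => ?_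
  rw [hτ.map_mul_comm, hx, zero_smul]

/-- A symmetrizing trace extends to a symmetrizing trace after extending the scalars. -/
lemma extend (K : Type*) [Field K] [Algebra R K] (hτ : IsSymmetrizingTrace τ) :
    IsSymmetrizingTrace (extendTrace K τ) := by
  obtain ⟨f, hassoc, hsymm, ⟨n, b, hdet⟩, hf⟩ := id hτ
  have hcomm : ∀ x y : K ⊗[R] A, extendTrace K τ (x * y) = extendTrace K τ (y * x) := by
    intro x y
    induction x with
    | zero => simp
    | add x₁ x₂ h₁ h₂ => simp only [add_mul, mul_add, map_add, h₁, h₂]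
    | tmul k a =>
      induction y with
      | zero => simp
      | add y₁ y₂ h₁ h₂ => simp only [add_mul, mul_add, map_add, h₁, h₂]
      | tmul k' a' =>
        simp only [Algebra.TensorProduct.tmul_mul_tmul, extendTrace_tmul, hτ.map_mul_comm a,
          mul_comm k]
  refine ⟨(LinearMap.mul K (K ⊗[R] A)).compr₂ (extendTrace K τ), fun a b c => ?_, fun a b => ?_,
    ⟨n, b.baseChange K, ?_⟩, fun a => ?_⟩
  · simp [mul_assoc]
  · simpa using hcomm a b
  · have h := hdet.map (algebraMap R K)
    rw [RingHom.map_det] at h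
    convert h using 2
    ext i j
    simp [Module.Basis.baseChange_apply, extendTrace_tmul, hf, hassoc, Algebra.smul_def]
  · simp

lemma dualFamily_baseChange (K : Type*) [Field K] [Algebra R K] {ι : Type*} [Fintype ι]
    (hτ : IsSymmetrizingTrace τ) (b : Module.Basis ι R A) (i : ι) :
    dualFamily (extendTrace K τ) (b.baseChange K) i = 1 ⊗ₜ[R] dualFamily τ b i := by
  refine (congrFun (dualFamily_unique (hτ.extend K) (b.baseChange K)
    (fun i => 1 ⊗ₜ[R] dualFamily τ b i) fun i j => ?_) i).symm
  simp [Module.Basis.baseChange_apply, extendTrace_tmul, mul_dualFamily hτ]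

end IsSymmetrizingTrace

section SplitSemisimple

variable {K B Λ : Type*} {M : Λ → Type*} [Field K] [Ring B] [Algebra K B]
  [∀ l, Fintype (M l)] (ρ : B ≃ₐ[K] ∀ l, Matrix (M l) (M l) K)

/-- The element of `B` acting as the matrix `X` on the `l`-th factor and as zero on the others. -/
def blockElement (l : Λ) : Matrix (M l) (M l) K →ₗ[K] B :=
  ρ.symm.toLinearMap ∘ₗ LinearMap.single K (fun l => Matrix (M l) (M l) K) l

lemma apply_blockElement_same (l : Λ) (X : Matrix (M l) (M l) K) :
    ρ (blockElement ρ l X) l = X := by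
  simp [blockElement]

lemma apply_blockElement_of_ne {l m : Λ} (h : m ≠ l) (X : Matrix (M l) (M l) K) :
    ρ (blockElement ρ l X) m = 0 := by
  simp [blockElement, h]

lemma blockElement_mul (l : Λ) (X : Matrix (M l) (M l) K) (b : B) :
    blockElement ρ l X * b = blockElement ρ l (X * ρ b l) := by
  apply ρ.injective
  funext m
  rw [map_mul, Pi.mul_apply]
  by_cases h : m = l
  · subst h; simp only [apply_blockElement_same]
  · simp only [apply_blockElement_of_ne ρ h, zero_mul]

lemma sum_blockElement [Fintype Λ] (b : B) : ∑ l, blockElement ρ l (ρ b l) = b := by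
  apply ρ.injective
  funext m
  rw [map_sum, Finset.sum_apply, Finset.sum_eq_single m]
  · rw [apply_blockElement_same]
  · intro l _ h
    rw [apply_blockElement_of_ne ρ h.symm]
  · simp

variable {τ : B →ₗ[K] K} (T : ∀ l, M l)

/-- The weight with which the trace of the `l`-th factor occurs in `τ`. -/
def traceWeight (τ : B →ₗ[K] K) (T : ∀ l, M l) (l : Λ) : K :=
  τ (blockElement ρ l (Matrix.single (T l) (T l) 1))

/-- On one block `τ` is a trace function, hence a multiple of the matrix trace; the multiple is its
value at any diagonal matrix unit, so `T` serves only to name one. -/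
lemma map_blockElement (hτ : IsSymmetrizingTrace τ) (l : Λ) (X : Matrix (M l) (M l) K) :
    τ (blockElement ρ l X) = traceWeight ρ τ T l * X.trace := by
  refine Matrix.eq_mul_trace_of_map_mul_comm (τ ∘ₗ blockElement ρ l) (fun X Y => ?_) (T l) X
  have h := hτ.map_mul_comm (blockElement ρ l X) (blockElement ρ l Y)
  rwa [blockElement_mul, blockElement_mul, apply_blockElement_same, apply_blockElement_same] at h

lemma map_eq_sum_trace [Fintype Λ] (hτ : IsSymmetrizingTrace τ) (b : B) :
    τ b = ∑ l, traceWeight ρ τ T l * (ρ b l).trace := by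
  conv_lhs => rw [← sum_blockElement ρ b]
  rw [map_sum]
  exact Finset.sum_congr rfl fun l _ => map_blockElement ρ T hτ l _

/-- A zero weight would put the whole block into the radical of the form. -/
lemma traceWeight_ne_zero (hτ : IsSymmetrizingTrace τ) (l : Λ) : traceWeight ρ τ T l ≠ 0 := by
  intro h
  have h0 : blockElement ρ l (Matrix.single (T l) (T l) 1) = 0 :=
    hτ.eq_zero_of_map_mul_eq_zero fun a => by
      rw [blockElement_mul, map_blockElement ρ T hτ, h, zero_mul]
  have h1 := apply_blockElement_same ρ l (Matrix.single (T l) (T l) 1)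
  rw [h0, map_zero, Pi.zero_apply] at h1
  simpa using congrFun (congrFun h1 (T l)) (T l)

/-- The orthogonality relations of the matrix coefficients. -/
lemma sum_apply_mul_apply_dualFamily {ι : Type*} [Fintype ι] (hτ : IsSymmetrizingTrace τ)
    (b : Module.Basis ι K B) (l : Λ) (P Q U V : M l) :
    ∑ i, ρ (b i) l P Q * ρ (dualFamily τ b i) l U V =
      if P = V ∧ Q = U then (traceWeight ρ τ T l)⁻¹ else 0 := by
  have ht := traceWeight_ne_zero ρ T hτ l
  -- Matrix entries are values of `τ` against matrix units. The sum thus becomes the `(P, Q)` entry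
  -- of the expansion of the unit at `(V, U)` in the basis `b`.
  have hd : ∀ a, ρ a l U V =
      (traceWeight ρ τ T l)⁻¹ * τ (a * blockElement ρ l (Matrix.single V U 1)) := by
    intro a
    rw [hτ.map_mul_comm, blockElement_mul, map_blockElement ρ T hτ, inv_mul_cancel_left₀ ht,
      Matrix.trace_single_mul, one_smul]
  have h := congrFun (congrFun (congrFun (congrArg ρ (hτ.sum_map_mul_smul b
    (blockElement ρ l (Matrix.single V U 1)))) l) P) Q
  rw [apply_blockElement_same, map_sum, Finset.sum_apply, Matrix.sum_apply] at h
  simp only [map_smul, Pi.smul_apply, Matrix.smul_apply, smul_eq_mul] at h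
  simp only [hd, mul_left_comm _ (traceWeight ρ τ T l)⁻¹, ← Finset.mul_sum]
  simp only [mul_comm (ρ _ l P Q), h, Matrix.single_apply]
  by_cases h' : P = V ∧ Q = U
  · simp [h'.1, h'.2]
  · rw [if_neg h', if_neg fun hh => h' ⟨hh.1.symm, hh.2.symm⟩, mul_zero]

lemma sum_apply_mul_mul_apply_dualFamily {ι : Type*} [Fintype ι] (hτ : IsSymmetrizingTrace τ)
    (b : Module.Basis ι K B) (l : Λ) (X : Matrix (M l) (M l) K) :
    ∑ i, ρ (b i) l * X * ρ (dualFamily τ b i) l =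
      ((traceWeight ρ τ T l)⁻¹ * X.trace) • (1 : Matrix (M l) (M l) K) := by
  ext P V
  have h : ∀ i, (ρ (b i) l * X * ρ (dualFamily τ b i) l) P V =
      ∑ U, ∑ Q, X Q U * (ρ (b i) l P Q * ρ (dualFamily τ b i) l U V) := by
    intro i
    simp only [Matrix.mul_apply, Finset.sum_mul]
    refine Finset.sum_congr rfl fun U _ => Finset.sum_congr rfl fun Q _ => by ring
  rw [Matrix.sum_apply]
  simp only [h]
  rw [Finset.sum_comm]
  simp only [Finset.sum_comm (s := Finset.univ (α := ι)), ← Finset.mul_sum,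
    sum_apply_mul_apply_dualFamily ρ T hτ b l]
  by_cases hPV : P = V
  · simp [hPV, Matrix.trace, Finset.mul_sum, mul_comm]
  · simp [hPV]

end SplitSemisimple

end MatrixProducts

/-! ### Idempotents and bases of the center. -/

section Center

open scoped Classical

namespace CompleteOrthogonalIdempotents

variable {K Z Λ : Type*} [Field K] [Ring Z] [Algebra K Z] [Fintype Λ] {e : Λ → Z}

lemma mul_apply_of_eq_sum (he : CompleteOrthogonalIdempotents e) {z : Z} {s : Λ → K}
    (hz : z = ∑ l, s l • e l) (l : Λ) : z * e l = s l • e l := by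
  rw [hz, Finset.sum_mul, Finset.sum_eq_single l]
  · rw [smul_mul_assoc, (he.idem l).eq]
  · intro m _ hm
    rw [smul_mul_assoc, he.ortho hm, smul_zero]
  · simp

/-- An idempotent acts on each `e l` by a scalar `s` with `s² = s` on `e l`; over a field this
leaves only `0` and the identity. -/
lemma mul_eq_zero_or_eq (he : CompleteOrthogonalIdempotents e)
    (hspan : ∀ z, ∃ s : Λ → K, z = ∑ l, s l • e l) {f : Z} (hf : IsIdempotentElem f) (l : Λ) :
    f * e l = 0 ∨ f * e l = e l := by
  obtain ⟨s, hs⟩ := hspan f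
  have h := he.mul_apply_of_eq_sum hs l
  have h2 : s l • s l • e l = s l • e l := by
    rw [← h, ← mul_smul_comm, ← h, ← mul_assoc, hf.eq]
  by_cases h0 : s l = 0
  · left; rw [h, h0, zero_smul]
  · right; rw [h]; exact smul_right_injective Z h0 h2

lemma isPrimitiveIdempotent (he : CompleteOrthogonalIdempotents e)
    (hspan : ∀ z, ∃ s : Λ → K, z = ∑ l, s l • e l) {l : Λ} (hl : e l ≠ 0) :
    IsPrimitiveIdempotent (e l) := by
  refine ⟨he.idem l, hl, fun f g hf _ hfg _ hsum => ?_⟩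
  have h1 : f * e l = f := by rw [← hsum, mul_add, hf.eq, hfg, add_zero]
  rcases he.mul_eq_zero_or_eq hspan hf l with h | h
  · left; rw [← h1, h]
  · right
    rw [h1] at h
    rwa [h, add_eq_left] at hsum

lemma exists_eq_of_isPrimitiveIdempotent (he : CompleteOrthogonalIdempotents e)
    (hspan : ∀ z, ∃ s : Λ → K, z = ∑ l, s l • e l) {f : Z} (hf : IsPrimitiveIdempotent f) :
    ∃ l, e l = f := by
  obtain ⟨hfi, hf0, hprim⟩ := hf
  have hsum : ∑ l, f * e l = f := by rw [← Finset.mul_sum, he.complete, mul_one]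
  obtain ⟨l, -, hl⟩ := Finset.exists_ne_zero_of_sum_ne_zero (hsum.trans_ne hf0)
  have h1 : f * e l = e l := (he.mul_eq_zero_or_eq hspan hfi l).resolve_left hl
  -- `Z` is not assumed commutative, so the other side needs its own computation. With both, `f = e
  -- l + (f - e l)` is an orthogonal decomposition and primitivity applies.
  have h2 : e l * f = e l := by
    obtain ⟨s, hs⟩ := hspan f
    rw [← h1, he.mul_apply_of_eq_sum hs l, smul_mul_assoc]
    congr 1
    rw [hs, Finset.mul_sum, Finset.sum_eq_single l]
    · rw [mul_smul_comm, (he.idem l).eq, ← he.mul_apply_of_eq_sum hs l, h1]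
    · intro m _ hm
      rw [mul_smul_comm, he.ortho hm.symm, smul_zero]
    · simp
  refine ⟨l, ?_⟩
  have hee := (he.idem l).eq
  have hg : IsIdempotentElem (f - e l) := by
    rw [IsIdempotentElem, sub_mul, mul_sub, mul_sub, hfi.eq, h1, h2, hee, sub_self, sub_zero]
  rcases hprim (e l) (f - e l) (he.idem l) hg (by rw [mul_sub, h2, hee, sub_self])
    (by rw [sub_mul, h1, hee, sub_self]) (by abel) with h | h
  · exact absurd (h1.trans h) hl
  · exact (sub_eq_zero.1 h).symm

end CompleteOrthogonalIdempotents

variable {K B Λ : Type*} {M : Λ → Type*} [Field K] [Ring B] [Algebra K B]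
  [∀ l, Fintype (M l)] (ρ : B ≃ₐ[K] ∀ l, Matrix (M l) (M l) K)

/-- The central idempotent of `B` that is the identity of the `l`-th factor. -/
def blockIdempotent (l : Λ) : Subalgebra.center K B :=
  ⟨blockElement ρ l 1, by
    rw [Subalgebra.mem_center_iff]
    intro b
    apply ρ.injective
    funext m
    rw [map_mul, map_mul, Pi.mul_apply, Pi.mul_apply]
    by_cases h : m = l
    · subst h; rw [apply_blockElement_same, mul_one, one_mul]
    · rw [apply_blockElement_of_ne ρ h, mul_zero, zero_mul]⟩

lemma coe_blockIdempotent (l : Λ) : (blockIdempotent ρ l : B) = blockElement ρ l 1 := rfl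

lemma blockIdempotent_ne_zero (l : Λ) [Nonempty (M l)] : blockIdempotent ρ l ≠ 0 := by
  intro h
  have h1 := apply_blockElement_same ρ l 1
  rw [← coe_blockIdempotent, h, ZeroMemClass.coe_zero, map_zero, Pi.zero_apply] at h1
  exact zero_ne_one h1

variable [Fintype Λ]

lemma completeOrthogonalIdempotents_blockIdempotent :
    CompleteOrthogonalIdempotents (blockIdempotent ρ) where
  idem l := Subtype.ext <| by
    simp only [MulMemClass.coe_mul, coe_blockIdempotent]
    rw [blockElement_mul, apply_blockElement_same, one_mul]
  ortho l m h := Subtype.ext <| by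
    simp only [MulMemClass.coe_mul, coe_blockIdempotent, ZeroMemClass.coe_zero]
    rw [blockElement_mul, apply_blockElement_of_ne ρ h, mul_zero, map_zero]
  complete := Subtype.ext <| by
    rw [AddSubmonoidClass.coe_finsetSum, OneMemClass.coe_one]
    have h := sum_blockElement ρ 1
    rwa [map_one] at h

lemma exists_eq_sum_smul_blockIdempotent (z : Subalgebra.center K B) :
    ∃ s : Λ → K, z = ∑ l, s l • blockIdempotent ρ l := by
  have h : ∀ l, ∃ s : K, ρ z l = s • (1 : Matrix (M l) (M l) K) := by
    intro l
    have h1 : ρ z l ∈ Set.range (Matrix.scalar (M l) : K →+* Matrix (M l) (M l) K) := by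
      rw [Matrix.mem_range_scalar_iff_commute_single]
      intro i j _
      -- A matrix commuting with the matrix units is scalar.
      have h2 := Subalgebra.mem_center_iff.1 z.2 (blockElement ρ l (Matrix.single i j 1))
      have h3 := congrFun (congrArg ρ h2) l
      rwa [map_mul, map_mul, Pi.mul_apply, Pi.mul_apply, apply_blockElement_same] at h3
    obtain ⟨s, hs⟩ := h1
    exact ⟨s, by rw [← hs, Matrix.scalar_apply, Matrix.smul_one_eq_diagonal]⟩
  choose s hs using h
  refine ⟨s, Subtype.ext ?_⟩
  rw [AddSubmonoidClass.coe_finsetSum]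
  conv_lhs => rw [← sum_blockElement ρ (z : B)]
  refine Finset.sum_congr rfl fun l _ => ?_
  rw [hs, map_smul]
  rfl

/-- Nonzero multiples of the block idempotents form a basis of the center. -/
lemma exists_basis_center_smul_blockIdempotent [∀ l, Nonempty (M l)] (c : Λ → K)
    (hc : ∀ l, c l ≠ 0) :
    ∃ b : Module.Basis Λ K (Subalgebra.center K B), ∀ l, b l = c l • blockIdempotent ρ l := by
  have he := completeOrthogonalIdempotents_blockIdempotent ρ
  have hli : LinearIndependent K fun l => c l • blockIdempotent ρ l := by
    rw [Fintype.linearIndependent_iff]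
    intro g hg l
    have h := he.mul_apply_of_eq_sum (z := 0) (s := fun l => g l * c l)
      (by simpa only [smul_smul] using hg.symm) l
    rw [zero_mul] at h
    have h2 := (smul_eq_zero.1 h.symm).resolve_right (blockIdempotent_ne_zero ρ l)
    exact (mul_eq_zero.1 h2).resolve_right (hc l)
  have hspan : ⊤ ≤ Submodule.span K (Set.range fun l => c l • blockIdempotent ρ l) := by
    intro z _
    obtain ⟨s, rfl⟩ := exists_eq_sum_smul_blockIdempotent ρ z
    refine Submodule.sum_mem _ fun l _ => ?_
    have : s l • blockIdempotent ρ l = (s l * (c l)⁻¹) • c l • blockIdempotent ρ l := by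
      rw [smul_smul, inv_mul_cancel_right₀ (hc l)]
    rw [this]
    exact Submodule.smul_mem _ _ (Submodule.subset_span ⟨l, rfl⟩)
  exact ⟨Module.Basis.mk hli hspan, fun l => Module.Basis.mk_apply hli hspan l⟩

end Center

/-! ### The elements `x_l` and the Schur elements of the cell modules. -/

section CellElements

open scoped Classical

namespace CellDatum

variable {K B Λ : Type*} {M : Λ → Type*} [Field K] [Ring B] [Algebra K B]
  [PartialOrder Λ] [Fintype Λ] [∀ l, Fintype (M l)] (D : CellDatum K B Λ M)
  {τ : B →ₗ[K] K}

/-- `τ (D^l C^m a)` is a coefficient of `C^m a` in the cell `l`, which is zero unless `l ≤ m`;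
nondegeneracy turns this into `D^l C^m = 0`. -/
lemma coeff_dualFamily_of_not_le (hτ : IsSymmetrizingTrace τ) {l m : Λ} (h : ¬ l ≤ m)
    (S T : M l) : D.coeff m (dualFamily τ D.basis ⟨l, S, T⟩) = 0 := by
  ext U V
  have h0 : dualFamily τ D.basis ⟨l, S, T⟩ * D.basis ⟨m, V, V⟩ = 0 :=
    hτ.eq_zero_of_map_mul_eq_zero fun a => by
      rw [mul_assoc, hτ.map_dualFamily_mul, D.repr_basis_mul_of_not_le h]
  rw [coeff, Matrix.of_apply, h0]
  simp

lemma characterOf_cellModule (l : Λ) (a : B) :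
    characterOf K (D.CellModule l) a = (D.coeff l a).trace :=
  Matrix.trace_toLin'_eq (D.coeff l a)

variable [IsSemisimpleRing B]

/-- This is the duality relation between `C^l` and `D^l` read in the block `l`: the opposite
triangularities of the two bases kill every other block in the expansion of `τ`. -/
lemma gram_mul_coeff_dualFamily (hτ : IsSymmetrizingTrace τ) (o : ∀ l, M l) (l : Λ) (S T : M l) :
    D.gram l * D.coeff l (dualFamily τ D.basis ⟨l, S, T⟩) =
      Matrix.single T S (traceWeight D.cellEquiv τ o l)⁻¹ := by
  ext V U
  have ht := traceWeight_ne_zero D.cellEquiv o hτ l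
  have h := mul_dualFamily hτ D.basis ⟨l, U, V⟩ ⟨l, S, T⟩
  rw [hτ.map_mul_comm, map_eq_sum_trace D.cellEquiv o hτ, Finset.sum_eq_single l] at h
  · have htr : (D.coeff l (D.basis ⟨l, U, V⟩) *
        D.coeff l (dualFamily τ D.basis ⟨l, S, T⟩)).trace =
        (D.gram l * D.coeff l (dualFamily τ D.basis ⟨l, S, T⟩)) V U := by
      simp only [Matrix.trace, Matrix.diag_apply, Matrix.mul_apply, D.coeff_basis_same, ite_mul,
        zero_mul]
      rw [Finset.sum_comm]
      simp
    rw [map_mul, Pi.mul_apply, cellEquiv_apply, cellEquiv_apply, htr] at h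
    rw [(eq_inv_mul_iff_mul_eq₀ ht).2 h, Matrix.single_apply]
    by_cases h' : T = V ∧ S = U
    · simp [h'.1, h'.2]
    · rw [if_neg h', if_neg, mul_zero]
      intro hh
      simp only [Sigma.mk.injEq, heq_eq_eq, Prod.mk.injEq, true_and] at hh
      exact h' ⟨hh.2.symm, hh.1.symm⟩
  · intro m _ hm
    rw [map_mul, Pi.mul_apply, cellEquiv_apply, cellEquiv_apply]
    by_cases hml : m ≤ l
    · rw [D.coeff_dualFamily_of_not_le hτ fun h' => hm (le_antisymm hml h'), mul_zero,
        Matrix.trace_zero, mul_zero]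
    · rw [D.coeff_basis_of_not_le hml, zero_mul, Matrix.trace_zero, mul_zero]
  · simp

lemma cellElement_eq (hτ : IsSymmetrizingTrace τ) (o : ∀ l, M l) (l : Λ) (T : M l) :
    D.cellElement τ T =
      (traceWeight D.cellEquiv τ o l)⁻¹ • (blockIdempotent D.cellEquiv l : B) := by
  apply D.cellEquiv.injective
  funext m
  rw [cellElement, map_smul, coe_blockIdempotent, map_sum, Finset.sum_apply, Pi.smul_apply]
  simp only [cellEquiv_apply, D.coeff_mul]
  by_cases h : m = l
  · subst h
    rw [← cellEquiv_apply, apply_blockElement_same]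
    ext P Q
    -- Each summand is supported in row `S`, where it is row `T` of the Gram matrix times the dual
    -- element: the single entry `t⁻¹` at `(S, S)`. Summing over `S` gives a scalar matrix that does
    -- not depend on `T`.
    have hS : ∀ S, (D.coeff m (D.basis ⟨m, S, T⟩) *
        D.coeff m (dualFamily τ D.basis ⟨m, S, T⟩)) P Q =
        if P = S then (D.gram m * D.coeff m (dualFamily τ D.basis ⟨m, S, T⟩)) T Q else 0 := by
      intro S
      simp only [Matrix.mul_apply, D.coeff_basis_same, ite_mul, zero_mul]
      split_ifs <;> simp
    simp only [Matrix.sum_apply, hS, D.gram_mul_coeff_dualFamily hτ o]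
    simp [Matrix.single_apply, Matrix.one_apply]
  · rw [← cellEquiv_apply, apply_blockElement_of_ne _ h, smul_zero]
    refine Finset.sum_eq_zero fun S _ => ?_
    by_cases hml : m ≤ l
    · rw [D.coeff_dualFamily_of_not_le hτ fun h' => h (le_antisymm hml h'), mul_zero]
    · rw [D.coeff_basis_of_not_le hml, zero_mul]

lemma isSchurElement_iff (hτ : IsSymmetrizingTrace τ) (o : ∀ l, M l) (l : Λ) (c : K) :
    IsSchurElement τ D.basis (D.CellModule l) c ↔ c = (traceWeight D.cellEquiv τ o l)⁻¹ := by
  have key : ∀ (φ : (M l → K) →ₗ[K] (M l → K)) (v : M l → K),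
      ∑ i, (D.coeff l (D.basis i)).mulVec
        (φ ((D.coeff l (dualFamily τ D.basis i)).mulVec v)) =
      ((traceWeight D.cellEquiv τ o l)⁻¹ * LinearMap.trace K _ φ) • v := by
    intro φ v
    have h := congrArg (fun X => Matrix.mulVec X v)
      (sum_apply_mul_mul_apply_dualFamily D.cellEquiv o hτ D.basis l (LinearMap.toMatrix' φ))
    simp only [Matrix.sum_mulVec, ← Matrix.mulVec_mulVec, LinearMap.toMatrix'_mulVec,
      Matrix.smul_mulVec, Matrix.one_mulVec, cellEquiv_apply] at h
    rw [h, ← Matrix.trace_toLin'_eq, Matrix.toLin'_toMatrix']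
  constructor
  · intro hc
    -- Uniqueness is tested on a map of trace `1`; the identity would not do, as the dimension may
    -- vanish in `K`.
    set φ := Matrix.toLin' (Matrix.single (o l) (o l) (1 : K))
    have h1 : ∑ i, (D.coeff l (D.basis i)).mulVec
        (φ ((D.coeff l (dualFamily τ D.basis i)).mulVec (Pi.single (o l) 1))) =
        (c * LinearMap.trace K _ φ) • Pi.single (o l) 1 := hc φ (Pi.single (o l) 1 : M l → K)
    rw [key, Matrix.trace_toLin'_eq, Matrix.trace_single_eq_same, mul_one, mul_one] at h1
    simpa using (congrFun h1 (o l)).symm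
  · rintro rfl φ v
    exact key φ v

lemma sum_characterOf_mul_characterOf (hτ : IsSymmetrizingTrace τ) (o : ∀ l, M l) (l : Λ) :
    ∑ i, characterOf K (D.CellModule l) (D.basis i) *
        characterOf K (D.CellModule l) (dualFamily τ D.basis i) =
      (traceWeight D.cellEquiv τ o l)⁻¹ * (Module.finrank K (D.CellModule l) : K) := by
  have hd : Module.finrank K (D.CellModule l) = Fintype.card (M l) :=
    Module.finrank_fintype_fun_eq_card K
  simp only [characterOf_cellModule, Matrix.trace, Matrix.diag_apply, Finset.sum_mul_sum]
  rw [Finset.sum_comm]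
  simp only [Finset.sum_comm (s := Finset.univ (α := Σ l, M l × M l)), ← cellEquiv_apply,
    sum_apply_mul_apply_dualFamily D.cellEquiv o hτ D.basis l]
  simp [hd, mul_comm]

end CellDatum

end CellElements

end

theorem proposition4p2
    {R A K Λ : Type*} {M : Λ → Type*}
    [CommRing R] [IsDomain R] [Ring A] [Algebra R A]
    [Field K] [Algebra R K] [IsFractionRing R K]
    [PartialOrder Λ] [Fintype Λ] [∀ l, Fintype (M l)]
    (D : CellDatum R A Λ M) (τ : A →ₗ[R] R) (hτ : IsSymmetrizingTrace τ)
    (hA : IsSplitSemisimple K (K ⊗[R] A))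
    -- an arbitrary choice of the indices used to form the elements `x_l`
    (T : ∀ l, M l) :
    let DK := D.extend K
    let τK := extendTrace K τ
    let x : Λ → K ⊗[R] A := fun l => 1 ⊗ₜ[R] D.cellElement τ (T l)
    let c : Λ → K := fun l => schurElement τK DK.basis (DK.CellModule l)
    -- the Schur elements of the cell modules are well defined and nonzero
    (∀ l, (∀ c' : K, IsSchurElement τK DK.basis (DK.CellModule l) c' ↔ c' = c l) ∧ c l ≠ 0 ∧
      ∑ i, characterOf K (DK.CellModule l) (DK.basis i) *
          characterOf K (DK.CellModule l) (dualFamily τK DK.basis i) =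
        c l * (Module.finrank K (DK.CellModule l) : K)) ∧
    -- the elements `c_l⁻¹ x_l` are the complete set of primitive idempotents of the center
    (∃ e : Λ → Subalgebra.center K (K ⊗[R] A),
      (∀ l, (e l : K ⊗[R] A) = (c l)⁻¹ • x l) ∧
      CompleteOrthogonalIdempotents e ∧
      (∀ l, IsPrimitiveIdempotent (e l)) ∧
      (∀ f, IsPrimitiveIdempotent f → ∃ l, e l = f)) ∧
    -- the elements `x_l` form a basis of the center
    (∃ b : Module.Basis Λ K (Subalgebra.center K (K ⊗[R] A)),
      ∀ l, (b l : K ⊗[R] A) = x l) := by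
  intro DK τK x c
  have : IsSemisimpleRing (K ⊗[R] A) := hA.semisimple
  have : ∀ l, Nonempty (M l) := fun l => ⟨T l⟩
  have hτK : IsSymmetrizingTrace τK := hτ.extend K
  -- The default value in `schurElement` never occurs, since a scalar with the defining property
  -- exists.
  have hc : ∀ l, c l = (traceWeight DK.cellEquiv τK T l)⁻¹ := fun l =>
    (DK.isSchurElement_iff hτK T l _).1
      (Classical.epsilon_spec ⟨_, (DK.isSchurElement_iff hτK T l _).2 rfl⟩)
  have hc0 : ∀ l, c l ≠ 0 := fun l => by
    rw [hc]
    exact inv_ne_zero (traceWeight_ne_zero _ T hτK l)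
  have hx : ∀ l, x l = c l • (blockIdempotent DK.cellEquiv l : K ⊗[R] A) := by
    intro l
    -- It remains to see that `x_l`, formed in `A`, becomes the cell element of `A_K`: dual bases
    -- commute with scalar extension.
    rw [hc, ← DK.cellElement_eq hτK T l (T l)]
    simp only [x, CellDatum.cellElement, TensorProduct.tmul_sum]
    refine Finset.sum_congr rfl fun S _ => ?_
    have hb : DK.basis = D.basis.baseChange K := rfl
    rw [hb, hτ.dualFamily_baseChange K, Module.Basis.baseChange_apply,
      Algebra.TensorProduct.tmul_mul_tmul, mul_one]
  have he := completeOrthogonalIdempotents_blockIdempotent DK.cellEquiv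
  have hspan := exists_eq_sum_smul_blockIdempotent DK.cellEquiv
  refine ⟨fun l => ⟨fun c' => ?_, hc0 l, ?_⟩, ⟨blockIdempotent DK.cellEquiv, fun l => ?_, he,
    fun l => he.isPrimitiveIdempotent hspan (blockIdempotent_ne_zero _ l),
    fun f hf => he.exists_eq_of_isPrimitiveIdempotent hspan hf⟩, ?_⟩
  · rw [hc]
    exact DK.isSchurElement_iff hτK T l c'
  · rw [hc]
    exact DK.sum_characterOf_mul_characterOf hτK T l
  · rw [hx, smul_smul, inv_mul_cancel₀ (hc0 l), one_smul]
  · obtain ⟨b, hb⟩ := exists_basis_center_smul_blockIdempotent DK.cellEquiv c hc0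
    exact ⟨b, fun l => by rw [hb, hx]; rfl⟩
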